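/- Conventions. A school matching instance $I=(A,B,\succ,q)$ consists of finite sets $A$ of students and $B$ of schools, a strict total order $\succ_a$ on $B\cup\{\emptyset\}$ for each $a\in A$, a strict total order $\succ_b$ on $A\cup\{\emptyset\}$ for each $b\in B$ ($\emptyset$ is the outside option), and quotas $q_b\le |A|$. A matching assigns to each student a school or $\emptyset$, so that each school $b$ receives at most $q_b$ students; it is viewed as a set of pairs, where a school $b$ with fewer than $q_b$ students is also paired with $\emptyset$. It is stable if no student prefers $\emptyset$ to her school, no school prefers $\emptyset$ to one of its students, and there is no pair $(a,b)\in A\times B$ such that $a$ strictly prefers $b$ to her partner and $b$ strictly prefers $a$ to one of its partners. Let $\mathcal S(I)$ be the set of stable matchings, ordered by $M\ge M'$ iff every student weakly prefers $M$ to $M'$, and let $M_0$ be its largest element. A rotation is a pair $\rho(M,M')=(M\setminus M',M'\setminus M)$ with $M,M'\in\mathcal S(I)$, $M'<M$ and no stable matching strictly between; it is then said to be exposed in $M$. Let $\mathcal R(I)$ be the set of rotations. Write $M=M_0/R$ if $R$ is the set of rotations on a chain $M_0>M_1>\dots>M_k=M$ in which each $M_i$ is an immediate predecessor of $M_{i-1}$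 (the set $R$ depends only on $M$, and $M$ only on $R$; write $M=M_R$). For rotations put $\rho\trianglerighteq\rho'$ if $\rho=\rho'$ or if $\rho\in R$ whenever $\rho'$ is exposed in $M=M_0/R$. For $\mathcal F\subseteq\mathcal S(I)$, the problem of minimizing $f:\mathcal F\to\mathbb R$ over $\mathcal F$ is minimum cut representable if there are a digraph on the vertex set $\mathcal R(I)\cup\{s,t\}$ with arc capacities in $[0,\infty]$ and a constant $C\in\mathbb R$ such that (i) for each $R\subseteq\mathcal R(I)$, the $s$-$t$ cut $\{s\}\cup R$ has finite capacity if and only if $R$ is upper-closed for $\trianglerighteq$ and $M_R\in\mathcal F$, and (ii) each such finite cut has value $f(M_R)+C$. An instance of (MSSP) is a school matching instance $I$ (whose schools are called classes) with a set $\mathcal C\subseteq A\times A$ of pairs of distinct students (siblings) and a partition of $B$ into nonempty sets called activities, such that each student $a$ has, for each activity, exactly one class $b$ of that activity with $b\succ_a\emptyset$, and such that for every $(a,\bar a)\in\mathcal C$ and any two activities, $a$ prefers her class of the first to her class of the second if and only if $\bar a$ prefers his class of the first to his class of the second. Lemma. There exists an instance of (MSSP) for which no function $f:\mathcal S(I)\to\mathbb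 R$ has both of the following properties: the problem $\min\{f(M):M\in\mathcal S(I)\}$ is minimum cut representable; and for every pair $M,M'\in\mathcal S(I)$, $f(M)<f(M')$ if and only if $M$ matches strictly more pairs of siblings in $\mathcal C$ to classes of the same activity than $M'$ does. -/

import Mathlib

open scoped ENNReal

/-- A school matching instance `(A, B, ≻, q)` over finite sets of students `A` and schools `B`.
`none` is the outside option `∅`; `studentPref a x y` reads `x ≻_a y` (on `B ∪ {∅}`) and
`schoolPref b x y` reads `x ≻_b y` (on `A ∪ {∅}`). -/
structure SchoolInstance (A B : Type) where
  finite_students : Finite A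
  finite_schools : Finite B
  studentPref : A → Option B → Option B → Prop
  studentPref_strictTotal : ∀ a, IsStrictTotalOrder (Option B) (studentPref a)
  schoolPref : B → Option A → Option A → Prop
  schoolPref_strictTotal : ∀ b, IsStrictTotalOrder (Option A) (schoolPref b)
  quota : B → ℕ
  quota_le : ∀ b, quota b ≤ Nat.card A

namespace SchoolInstance

variable {A B : Type} (I : SchoolInstance A B)

/-- A matching: every student gets one school or the outside option, and no school exceeds its
quota. The associated set of pairs, which also records unfilled schools, is `Matching.pairs`. -/
@[ext]
structure Matching where
  partner : A → Option B
  card_le : ∀ b, {a | partner a = some b}.ncard ≤ I.quota b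

variable {I}

/-- The matching as a set of pairs in `(A ∪ {∅}) × (B ∪ {∅})`: each student with its partner, and
each school with fewer students than its quota with the outside option. -/
def Matching.pairs (M : I.Matching) : Set (Option A × Option B) :=
  {p | (∃ a, p = (some a, M.partner a)) ∨
    ∃ b, {a | M.partner a = some b}.ncard < I.quota b ∧ p = (none, some b)}

/-- The partners `M(b) ⊆ A ∪ {∅}` of a school `b`. -/
def Matching.schoolPartners (M : I.Matching) (b : B) : Set (Option A) :=
  {x | (x, some b) ∈ M.pairs}

/-- `ab` is a blocking pair. -/
def Matching.IsBlockingPair (M : I.Matching) (a : A) (b : B) : Prop :=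
  I.studentPref a (some b) (M.partner a) ∧
    ∃ x ∈ M.schoolPartners b, I.schoolPref b (some a) x

/-- Student `a` prefers the outside option to its assigned school. -/
def Matching.IsBlockingStudent (M : I.Matching) (a : A) : Prop :=
  I.studentPref a none (M.partner a)

/-- School `b` prefers the outside option to one of its assigned students. -/
def Matching.IsBlockingSchool (M : I.Matching) (b : B) : Prop :=
  ∃ a, M.partner a = some b ∧ I.schoolPref b none (some a)

/-- No blocking pairs and no blocking agents. -/
def Matching.IsStable (M : I.Matching) : Prop :=
  (∀ a b, ¬ M.IsBlockingPair a b) ∧ (∀ a, ¬ M.IsBlockingStudent a) ∧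
    ∀ b, ¬ M.IsBlockingSchool b

variable (I)

/-- The set `S(I)` of stable matchings, as a type. -/
def StableMatching : Type := {M : I.Matching // M.IsStable}

/-- `M' ≤ M` iff every student weakly prefers `M` to `M'`. -/
instance : PartialOrder I.StableMatching where
  le M' M := ∀ a, M.1.partner a = M'.1.partner a ∨
    I.studentPref a (M.1.partner a) (M'.1.partner a)
  le_refl _ _ := Or.inl rfl
  le_trans M₁ M₂ M₃ h₁ h₂ a := by
    have := I.studentPref_strictTotal a
    rcases h₁ a with e | e
    · rw [← e]; exact h₂ a
    · rcases h₂ a with e' | e'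
      · rw [e']; exact Or.inr e
      · exact Or.inr (_root_.trans e' e)
  le_antisymm M₁ M₂ h₁ h₂ := by
    apply Subtype.ext
    apply Matching.ext
    funext a
    have := I.studentPref_strictTotal a
    rcases h₁ a with e | e
    · exact e.symm
    · rcases h₂ a with e' | e'
      · exact e'
      · exact absurd e' (asymm_of (I.studentPref a) e)

variable {I}

/-- The pair `ρ(M, M') = (M \ M', M' \ M)`. -/
def rotationPair (M M' : I.StableMatching) :
    Set (Option A × Option B) × Set (Option A × Option B) :=
  (M.1.pairs \ M'.1.pairs, M'.1.pairs \ M.1.pairs)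

variable (I)

/-- The rotations `R(I)`: the pairs `ρ(M, M')` with `M'` an immediate predecessor of `M`,
that is, `M' < M` with no stable matching strictly between (written `M' ⋖ M`). -/
def Rotation : Type :=
  {ρ : Set (Option A × Option B) × Set (Option A × Option B) //
    ∃ M M' : I.StableMatching, M' ⋖ M ∧ ρ = rotationPair M M'}

variable {I}

/-- The rotation `ρ(M, M')`. -/
def rotation (M M' : I.StableMatching) (h : M' ⋖ M) : I.Rotation :=
  ⟨rotationPair M M', M, M', h, rfl⟩

/-- `ρ` is exposed in `M`. -/
def Rotation.IsExposed (ρ : I.Rotation) (M : I.StableMatching) : Prop :=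
  ∃ (M' : I.StableMatching) (h : M' ⋖ M), ρ = rotation M M' h

/-- `IsElimination M R` says `M = M₀ / R`: there is a chain of immediate predecessors from the
student-optimal stable matching `M₀` to `M` whose set of rotations is `R`. -/
inductive IsElimination : I.StableMatching → Set I.Rotation → Prop
  | optimal (M₀ : I.StableMatching) (h : ∀ M, M ≤ M₀) : IsElimination M₀ ∅
  | step (M M' : I.StableMatching) (R : Set I.Rotation) (h : M' ⋖ M) :
      IsElimination M R → IsElimination M' (insert (rotation M M' h) R)

/-- The order `ρ ⊵ ρ'` of the poset of rotations: `ρ = ρ'`, or `ρ` is eliminated before any stable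
matching in which `ρ'` is exposed. -/
def Rotation.Above (ρ ρ' : I.Rotation) : Prop :=
  ρ = ρ' ∨ ∀ (M : I.StableMatching) (R : Set I.Rotation),
    ρ'.IsExposed M → IsElimination M R → ρ ∈ R

/-- Upper-closed sets of rotations. -/
def IsUpperClosed (R : Set I.Rotation) : Prop :=
  ∀ ρ' ∈ R, ∀ ρ : I.Rotation, ρ.Above ρ' → ρ ∈ R

variable (I)

/-- The vertices `R(I) ∪ {s, t}` of a witness digraph. -/
inductive CutVertex where
  | source : CutVertex
  | sink : CutVertex
  | rot (ρ : I.Rotation) : CutVertex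

variable {I}

/-- The vertex set `{s} ∪ R`. -/
def cutSet (R : Set I.Rotation) : Set I.CutVertex :=
  {CutVertex.source} ∪ CutVertex.rot '' R

end SchoolInstance

open Classical in
/-- The value of the cut `X` in a digraph with arc capacities in `[0, ∞]`: the total capacity of
the arcs that leave `X`. -/
noncomputable def cutValue {V : Type} (D : Digraph V) (cap : V → V → ℝ≥0∞) (X : Set V) : ℝ≥0∞ :=
  ∑' (u : V) (v : V), if D.Adj u v ∧ u ∈ X ∧ v ∉ X then cap u v else 0

namespace SchoolInstance

/-- The problem `min {f(M) : M ∈ F}` is minimum cut representable. -/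
def MinCutRepresentable {A B : Type} (I : SchoolInstance A B) (F : Set I.StableMatching)
    (f : F → ℝ) : Prop :=
  ∃ (D : Digraph I.CutVertex) (cap : I.CutVertex → I.CutVertex → ℝ≥0∞) (C : ℝ),
    (∀ R : Set I.Rotation, cutValue D cap (cutSet R) < ∞ ↔
      IsUpperClosed R ∧ ∃ M ∈ F, IsElimination M R) ∧
    (∀ R : Set I.Rotation, cutValue D cap (cutSet R) < ∞ →
      ∀ M : F, IsElimination M.1 R → (cutValue D cap (cutSet R)).toReal = f M + C)

end SchoolInstance

/-- An instance of (MSSP): a school matching instance with a set of pairs of siblings and a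
partition of the schools (called classes) into the activities `Q`. -/
structure MSSPInstance (A B Q : Type) extends SchoolInstance A B where
  siblings : Finset (A × A)
  siblings_ne : ∀ p ∈ siblings, p.1 ≠ p.2
  /-- the activity of a class -/
  activity : B → Q
  /-- every activity has a class -/
  activity_surjective : Function.Surjective activity
  /-- every student is eligible for exactly one class of each activity -/
  eligible_unique : ∀ (a : A) (j : Q), ∃! b : B, activity b = j ∧ studentPref a (some b) none
  /-- siblings rank the activities in the same order -/
  same_order : ∀ p ∈ siblings, ∀ b₁ b₂ c₁ c₂ : B,
    activity b₁ = activity c₁ → activity b₂ = activity c₂ →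
    studentPref p.1 (some b₁) none → studentPref p.1 (some b₂) none →
    studentPref p.2 (some c₁) none → studentPref p.2 (some c₂) none →
    (studentPref p.1 (some b₁) (some b₂) ↔ studentPref p.2 (some c₁) (some c₂))

namespace MSSPInstance

variable {A B Q : Type} (J : MSSPInstance A B Q)

/-- `M` matches `a` and `a'` to classes of the same activity. -/
def SameActivity (M : J.toSchoolInstance.StableMatching) (a a' : A) : Prop :=
  ∃ b b' : B, M.1.partner a = some b ∧ M.1.partner a' = some b' ∧ J.activity b = J.activity b'

open Classical in
/-- The number of sibling pairs that `M` matches to the same activity. -/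
noncomputable def numSameActivity (M : J.toSchoolInstance.StableMatching) : ℕ :=
  (J.siblings.filter fun p => J.SameActivity M p.1 p.2).card

end MSSPInstance

/-!
The value of an `s`-`t` cut is submodular. Hence, if two distinct rotations `ρ`, `σ` are exposed in
a stable matching `K` and can be eliminated in either order, a minimum cut representable `f`
satisfies `f K + f (K / {ρ, σ}) ≤ f (K / ρ) + f (K / σ)`.

Take three activities and two siblings `x`, `y` who both rank them `0, 1, 2`. In the
student-optimal matching `K`, `x` attends activity `0` and `y`, whose class of activity `0` is
always full, attends activity `1`. Independent rotations `ρ` and `σ` move `x` to activity `1` and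
`y` to activity `2`. Only `ρ` alone brings the siblings together, so `f (K / ρ) < f K` while
`f (K / σ) = f (K / {ρ, σ})`, contradicting the inequality.
-/

theorem cutValue_inter_add_cutValue_union_le {V : Type} (D : Digraph V) (cap : V → V → ℝ≥0∞)
    (X Y : Set V) :
    cutValue D cap (X ∩ Y) + cutValue D cap (X ∪ Y) ≤ cutValue D cap X + cutValue D cap Y := by
  classical
  simp only [cutValue, ← ENNReal.tsum_add]
  refine ENNReal.tsum_le_tsum fun u => ENNReal.tsum_le_tsum fun v => ?_
  by_cases huX : u ∈ X <;> by_cases huY : u ∈ Y <;> by_cases hvX : v ∈ X <;>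
    by_cases hvY : v ∈ Y <;> simp [huX, huY, hvX, hvY]

/-- `Precedes l x y` is the preference order of an agent whose preference list, from best to worst,
is `l`. An entry missing from `l` comes after all the others. -/
def Precedes {α : Type*} [DecidableEq α] (l : List α) (x y : α) : Prop :=
  l.idxOf x < l.idxOf y

instance {α : Type*} [DecidableEq α] (l : List α) : DecidableRel (Precedes l) :=
  fun x y => inferInstanceAs (Decidable (l.idxOf x < l.idxOf y))

theorem isStrictTotalOrder_precedes {α : Type*} [DecidableEq α] {l : List α} (hl : ∀ x, x ∈ l) :
    IsStrictTotalOrder α (Precedes l) :=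
  Function.Injective.isStrictTotalOrder_onFun (r := (· < ·)) (f := l.idxOf)
    fun x _ h => (List.idxOf_inj (hl x)).1 h

theorem ncard_setOf_equiv_eq_some {A B : Type*} (e : A ≃ B) (b : B) :
    {a | some (e a) = some b}.ncard = 1 :=
  Set.ncard_eq_one.2 ⟨e.symm b, by ext a; simp [Equiv.eq_symm_apply]⟩

namespace SchoolInstance

variable {A B : Type} {I : SchoolInstance A B}

@[simp]
theorem Matching.some_mem_pairs {M : I.Matching} {a : A} {y : Option B} :
    (some a, y) ∈ M.pairs ↔ M.partner a = y := by
  simp [Matching.pairs, eq_comm]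

theorem Matching.pairs_injective : Function.Injective (Matching.pairs (I := I)) :=
  fun M N h => Matching.ext <| funext fun a => by
    rw [← Matching.some_mem_pairs, h, Matching.some_mem_pairs]

theorem Matching.schoolPartners_nonempty (M : I.Matching) {b : B} (hb : 0 < I.quota b) :
    (M.schoolPartners b).Nonempty := by
  by_cases h : ∃ a, M.partner a = some b
  · obtain ⟨a, ha⟩ := h
    exact ⟨some a, Matching.some_mem_pairs.2 ha⟩
  · have hempty : {a | M.partner a = some b} = ∅ :=
      Set.eq_empty_of_forall_notMem (not_exists.1 h)
    exact ⟨none, Or.inr ⟨b, by rwa [hempty, Set.ncard_empty], rfl⟩⟩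

theorem Matching.IsStable.partner_eq_or_studentPref_of_favorite {M : I.Matching}
    (hM : M.IsStable) {a : A} {b : B} (hb : 0 < I.quota b)
    (hfav : ∀ x, x ≠ some a → I.schoolPref b (some a) x) :
    M.partner a = some b ∨ I.studentPref a (M.partner a) (some b) := by
  have := I.studentPref_strictTotal a
  rcases trichotomous_of (I.studentPref a) (M.partner a) (some b) with hlt | heq | hgt
  · exact Or.inr hlt
  · exact Or.inl heq
  · obtain ⟨x, hx⟩ := M.schoolPartners_nonempty hb
    have hxa : x ≠ some a := by
      rintro rfl
      rw [Matching.some_mem_pairs.1 hx] at hgt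
      exact irrefl_of (I.studentPref a) _ hgt
    exact (hM.1 a b ⟨hgt, x, hx, hfav x hxa⟩).elim

theorem Matching.eq_of_partner_eq_some (M : I.Matching) {a a' : A} {b : B} (hb : I.quota b ≤ 1)
    (ha : M.partner a = some b) (ha' : M.partner a' = some b) : a = a' :=
  have := I.finite_students
  (Set.ncard_le_one (Set.toFinite _)).1 ((M.card_le b).trans hb) a ha a' ha'

theorem Matching.partner_eq_and_partner_eq_or_swap (M : I.Matching) {a a' : A} (hne : a ≠ a')
    {b b' : B} (hb : I.quota b ≤ 1) (hb' : I.quota b' ≤ 1)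
    (ha : M.partner a = some b ∨ M.partner a = some b')
    (ha' : M.partner a' = some b ∨ M.partner a' = some b') :
    M.partner a = some b ∧ M.partner a' = some b' ∨
      M.partner a = some b' ∧ M.partner a' = some b := by
  rcases ha with ha | ha <;> rcases ha' with ha' | ha'
  · exact (hne (M.eq_of_partner_eq_some hb ha ha')).elim
  · exact Or.inl ⟨ha, ha'⟩
  · exact Or.inr ⟨ha, ha'⟩
  · exact (hne (M.eq_of_partner_eq_some hb' ha ha')).elim

/-- The perfect matching given by a bijection between the students and the schools of an instance
in which every school has quota one. -/
def Matching.ofEquiv (hquota : ∀ b, I.quota b = 1) (e : A ≃ B) : I.Matching where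
  partner a := some (e a)
  card_le b := (ncard_setOf_equiv_eq_some e b).trans_le (hquota b).ge

theorem Matching.mem_pairs_ofEquiv {hquota : ∀ b, I.quota b = 1} {e : A ≃ B}
    {p : Option A × Option B} :
    p ∈ (Matching.ofEquiv hquota e).pairs ↔ ∃ a, p = (some a, some (e a)) := by
  refine ⟨?_, Or.inl⟩
  rintro (h | ⟨b, hlt, -⟩)
  · exact h
  · exact absurd ((ncard_setOf_equiv_eq_some e b).trans (hquota b).symm) hlt.ne

theorem Matching.isStable_ofEquiv (hquota : ∀ b, I.quota b = 1) (e : A ≃ B)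
    (hpair : ∀ a a', I.studentPref a (some (e a')) (some (e a)) →
      ¬ I.schoolPref (e a') (some a) (some a'))
    (hstudent : ∀ a, ¬ I.studentPref a none (some (e a)))
    (hschool : ∀ a, ¬ I.schoolPref (e a) none (some a)) :
    (Matching.ofEquiv hquota e).IsStable := by
  refine ⟨?_, hstudent, ?_⟩
  · rintro a b ⟨hab, x, hx, hbx⟩
    obtain ⟨a', heq⟩ := Matching.mem_pairs_ofEquiv.1 hx
    obtain ⟨rfl, hb⟩ := Prod.mk_inj.1 heq
    obtain rfl := Option.some_inj.1 hb
    exact hpair a a' hab hbx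
  · rintro b ⟨a, ha, hb⟩
    obtain rfl := Option.some_inj.1 ha
    exact hschool a hb

theorem rotationPair_injective (M : I.StableMatching) : Function.Injective (rotationPair M) := by
  intro N N' h
  obtain ⟨hsub, hadd⟩ := Prod.mk_inj.1 h
  have hsymmDiff : symmDiff M.1.pairs N.1.pairs = symmDiff M.1.pairs N'.1.pairs :=
    congrArg₂ (· ∪ ·) hsub hadd
  exact Subtype.ext (Matching.pairs_injective (symmDiff_right_injective _ hsymmDiff))

theorem IsElimination.isUpperClosed {M : I.StableMatching} {R : Set I.Rotation}
    (h : IsElimination M R) : IsUpperClosed R := by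
  induction h with
  | optimal => exact fun _ h => h.elim
  | step M M' R hcov hR ih =>
    rintro ρ' (rfl | hρ') ρ hρ
    · rcases hρ with rfl | hρ
      · exact Set.mem_insert _ _
      · exact Set.mem_insert_of_mem _ (hρ M R ⟨M', hcov, rfl⟩ hR)
    · exact Set.mem_insert_of_mem _ (ih ρ' hρ' ρ hρ)

theorem cutSet_inter (R S : Set I.Rotation) : cutSet (R ∩ S) = cutSet R ∩ cutSet S := by
  ext v
  cases v <;> simp [cutSet]

theorem cutSet_union (R S : Set I.Rotation) : cutSet (R ∪ S) = cutSet R ∪ cutSet S := by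
  ext v
  cases v <;> simp [cutSet]

theorem MinCutRepresentable.add_le_add_of_inter_of_union {F : Set I.StableMatching} {f : F → ℝ}
    (h : I.MinCutRepresentable F f) {M N K L : F} {R S : Set I.Rotation}
    (hM : IsElimination M.1 R) (hN : IsElimination N.1 S)
    (hK : IsElimination K.1 (R ∩ S)) (hL : IsElimination L.1 (R ∪ S)) :
    f K + f L ≤ f M + f N := by
  obtain ⟨D, cap, C, hfinite, hvalue⟩ := h
  have cut_lt_top {P : F} {T : Set I.Rotation} (hP : IsElimination P.1 T) :
      cutValue D cap (cutSet T) < ∞ :=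
    (hfinite T).2 ⟨hP.isUpperClosed, P.1, P.2, hP⟩
  have toReal_cut {P : F} {T : Set I.Rotation} (hP : IsElimination P.1 T) :
      (cutValue D cap (cutSet T)).toReal = f P + C :=
    hvalue T (cut_lt_top hP) P hP
  have hcut := cutValue_inter_add_cutValue_union_le D cap (cutSet R) (cutSet S)
  rw [← cutSet_inter, ← cutSet_union] at hcut
  have hsum : f K + C + (f L + C) ≤ f M + C + (f N + C) := by
    rw [← toReal_cut hK, ← toReal_cut hL, ← toReal_cut hM, ← toReal_cut hN,
      ← ENNReal.toReal_add (cut_lt_top hK).ne (cut_lt_top hL).ne,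
      ← ENNReal.toReal_add (cut_lt_top hM).ne (cut_lt_top hN).ne]
    exact ENNReal.toReal_mono
      (ENNReal.add_ne_top.2 ⟨(cut_lt_top hM).ne, (cut_lt_top hN).ne⟩) hcut
  linarith

theorem MinCutRepresentable.add_le_add_of_diamond {F : Set I.StableMatching} {f : F → ℝ}
    (h : I.MinCutRepresentable F f) {K M N L : F} {R : Set I.Rotation}
    (hK : IsElimination K.1 R) (hKM : M.1 ⋖ K.1) (hKN : N.1 ⋖ K.1) (hNL : L.1 ⋖ N.1)
    (hMN : M.1 ≠ N.1) (hrot : rotation K.1 M.1 hKM = rotation N.1 L.1 hNL) :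
    f K + f L ≤ f M + f N := by
  have hM := hK.step _ _ _ hKM
  have hN := hK.step _ _ _ hKN
  have hL := hN.step _ _ _ hNL
  have hne : rotation K.1 M.1 hKM ≠ rotation K.1 N.1 hKN := fun heq =>
    hMN (rotationPair_injective K.1 (congrArg Subtype.val heq))
  rw [← hrot] at hL
  refine h.add_le_add_of_inter_of_union hM hN ?_ ?_
  · simpa only [← Set.union_singleton, ← Set.union_inter_distrib_left,
      (Set.disjoint_singleton.2 hne).inter_eq, Set.union_empty] using hK
  · rwa [Set.insert_union, Set.union_eq_right.2 (Set.subset_insert _ _)]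

end SchoolInstance

theorem MSSPInstance.numSameActivity_of_siblings_eq_singleton {A B Q : Type}
    {J : MSSPInstance A B Q} {a a' : A} (hJ : J.siblings = {(a, a')})
    (M : J.toSchoolInstance.StableMatching) [Decidable (J.SameActivity M a a')] :
    J.numSameActivity M = if J.SameActivity M a a' then 1 else 0 := by
  simp only [MSSPInstance.numSameActivity, hJ, Finset.filter_singleton]
  split_ifs <;> rfl

open SchoolInstance

namespace SiblingExample

/-- The preference lists of the students, best class first; the classes after `none` are those for
which the student is not eligible. -/
def studentList : Fin 4 → List (Option (Fin 4)) :=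
  ![[some 0, some 1, some 3, none, some 2],
    [some 1, some 0, some 3, none, some 2],
    [some 0, some 2, some 3, none, some 1],
    [some 3, some 2, some 0, none, some 1]]

/-- The preference lists of the classes, best student first. -/
def classList : Fin 4 → List (Option (Fin 4)) :=
  ![[some 1, some 0, some 2, some 3, none],
    [some 0, some 1, some 2, some 3, none],
    [some 3, some 2, some 0, some 1, none],
    [some 2, some 3, some 0, some 1, none]]

/-- The instance of (MSSP) without a suitable objective. The siblings are the students `0` and `2`;
the classes `1` and `2` belong to the same activity. -/
def inst : MSSPInstance (Fin 4) (Fin 4) (Fin 3) where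
  finite_students := inferInstance
  finite_schools := inferInstance
  studentPref a := Precedes (studentList a)
  studentPref_strictTotal a := isStrictTotalOrder_precedes (by revert a; decide)
  schoolPref b := Precedes (classList b)
  schoolPref_strictTotal b := isStrictTotalOrder_precedes (by revert b; decide)
  quota _ := 1
  quota_le _ := by simp
  siblings := {(0, 2)}
  siblings_ne := by decide
  activity := ![0, 1, 1, 2]
  activity_surjective := by unfold Function.Surjective; decide
  eligible_unique := by unfold ExistsUnique; decide
  same_order := by
    simp only [Finset.mem_singleton, forall_eq]
    decide

instance (a : Fin 4) : DecidableRel (inst.studentPref a) :=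
  inferInstanceAs (DecidableRel (Precedes (studentList a)))

instance (b : Fin 4) : DecidableRel (inst.schoolPref b) :=
  inferInstanceAs (DecidableRel (Precedes (classList b)))

/-- The students `0` and `1` swap their classes if `s.1` holds, and the students `2` and `3` swap
theirs if `s.2` holds. -/
def assignment (s : Bool × Bool) : Equiv.Perm (Fin 4) :=
  (if s.1 then Equiv.swap 0 1 else 1) * (if s.2 then Equiv.swap 2 3 else 1)

theorem isStable_assignment (s : Bool × Bool) :
    (Matching.ofEquiv (I := inst.toSchoolInstance) (fun _ => rfl) (assignment s)).IsStable :=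
  Matching.isStable_ofEquiv _ _ (by revert s; decide) (by revert s; decide) (by revert s; decide)

/-- The stable matching in which the swaps selected by `s` have been carried out. -/
def stable (s : Bool × Bool) : inst.toSchoolInstance.StableMatching :=
  ⟨Matching.ofEquiv (fun _ => rfl) (assignment s), isStable_assignment s⟩

theorem stable_le_stable_iff {s t : Bool × Bool} : stable s ≤ stable t ↔ t ≤ s := by
  have le_iff : ∀ s t : Bool × Bool, (∀ a, some (assignment t a) = some (assignment s a) ∨
      inst.studentPref a (some (assignment t a)) (some (assignment s a))) ↔ t ≤ s := by decide
  exact le_iff s t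

theorem partner_of_favorite (M : inst.toSchoolInstance.StableMatching) (a b : Fin 4)
    (hfav : ∀ x, x ≠ some a → inst.schoolPref b (some a) x) :
    M.1.partner a = some b ∨ inst.studentPref a (M.1.partner a) (some b) :=
  M.2.partner_eq_or_studentPref_of_favorite Nat.one_pos hfav

theorem partner_zero_one (M : inst.toSchoolInstance.StableMatching) :
    M.1.partner 0 = some 0 ∧ M.1.partner 1 = some 1 ∨
      M.1.partner 0 = some 1 ∧ M.1.partner 1 = some 0 := by
  have rank_zero : ∀ x, x = some 1 ∨ inst.studentPref 0 x (some 1) → x = some 0 ∨ x = some 1 := by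
    decide
  have rank_one : ∀ x, x = some 0 ∨ inst.studentPref 1 x (some 0) → x = some 0 ∨ x = some 1 := by
    decide
  exact M.1.partner_eq_and_partner_eq_or_swap (by decide) le_rfl le_rfl
    (rank_zero _ (partner_of_favorite M 0 1 (by decide)))
    (rank_one _ (partner_of_favorite M 1 0 (by decide)))

theorem partner_two_three (M : inst.toSchoolInstance.StableMatching) :
    M.1.partner 2 = some 2 ∧ M.1.partner 3 = some 3 ∨
      M.1.partner 2 = some 3 ∧ M.1.partner 3 = some 2 := by
  have rank_two : ∀ x, x = some 3 ∨ inst.studentPref 2 x (some 3) → x ≠ some 0 →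
      x = some 2 ∨ x = some 3 := by decide
  have rank_three : ∀ x, x = some 2 ∨ inst.studentPref 3 x (some 2) →
      x = some 2 ∨ x = some 3 := by decide
  have not_zero : M.1.partner 2 ≠ some 0 := by
    intro h
    rcases partner_zero_one M with ⟨h', -⟩ | ⟨-, h'⟩ <;>
      exact absurd (M.1.eq_of_partner_eq_some le_rfl h h') (by decide)
  exact M.1.partner_eq_and_partner_eq_or_swap (by decide) le_rfl le_rfl
    (rank_two _ (partner_of_favorite M 2 3 (by decide)) not_zero)
    (rank_three _ (partner_of_favorite M 3 2 (by decide)))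

theorem stable_injective : Function.Injective stable := fun _ _ h =>
  le_antisymm (stable_le_stable_iff.1 h.ge) (stable_le_stable_iff.1 h.le)

theorem stable_surjective : Function.Surjective stable := by
  intro M
  have stable_eq (s : Bool × Bool) (h₀ : M.1.partner 0 = some (assignment s 0))
      (h₁ : M.1.partner 1 = some (assignment s 1)) (h₂ : M.1.partner 2 = some (assignment s 2))
      (h₃ : M.1.partner 3 = some (assignment s 3)) : stable s = M := by
    refine Subtype.ext (Matching.ext (funext fun a => ?_))
    fin_cases a
    exacts [h₀.symm, h₁.symm, h₂.symm, h₃.symm]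
  rcases partner_zero_one M with ⟨h₀, h₁⟩ | ⟨h₀, h₁⟩ <;>
    rcases partner_two_three M with ⟨h₂, h₃⟩ | ⟨h₂, h₃⟩
  · exact ⟨(false, false), stable_eq _ h₀ h₁ h₂ h₃⟩
  · exact ⟨(false, true), stable_eq _ h₀ h₁ h₂ h₃⟩
  · exact ⟨(true, false), stable_eq _ h₀ h₁ h₂ h₃⟩
  · exact ⟨(true, true), stable_eq _ h₀ h₁ h₂ h₃⟩

/-- The stable matchings form a square. The order is reversed since each swap is a loss for the
students. -/
noncomputable def stableOrderIso : (Bool × Bool)ᵒᵈ ≃o inst.toSchoolInstance.StableMatching :=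
  OrderIso.ofSurjective (OrderEmbedding.ofMapLEIff (stable ∘ OrderDual.ofDual)
    fun _ _ => stable_le_stable_iff) stable_surjective

theorem stable_covBy_stable_iff {s t : Bool × Bool} : stable s ⋖ stable t ↔ t ⋖ s :=
  (apply_covBy_apply_iff stableOrderIso).trans toDual_covBy_toDual_iff

theorem stable_covBy_left (j : Bool) : stable (true, j) ⋖ stable (false, j) :=
  stable_covBy_stable_iff.2 (Prod.mk_covBy_mk_iff_left.2 (by decide))

theorem stable_covBy_right (i : Bool) : stable (i, true) ⋖ stable (i, false) :=
  stable_covBy_stable_iff.2 (Prod.mk_covBy_mk_iff_right.2 (by decide))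

theorem rotationPair_left (j : Bool) :
    rotationPair (stable (false, j)) (stable (true, j)) =
      ({(some 0, some 0), (some 1, some 1)}, {(some 0, some 1), (some 1, some 0)}) := by
  have mem_pairs (s : Bool × Bool) (p : Option (Fin 4) × Option (Fin 4)) :
      p ∈ (stable s).1.pairs ↔ ∃ a, p = (some a, some (assignment s a)) :=
    Matching.mem_pairs_ofEquiv (hquota := fun _ => rfl)
  refine Prod.ext (Set.ext fun p => ?_) (Set.ext fun p => ?_) <;>
  · simp only [rotationPair, Set.mem_sdiff, mem_pairs, Set.mem_insert_iff, Set.mem_singleton_iff]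
    revert j p
    decide

theorem isElimination_stable_bot : IsElimination (stable (false, false)) ∅ :=
  .optimal _ fun M => by
    obtain ⟨s, rfl⟩ := stable_surjective M
    exact stable_le_stable_iff.2 bot_le

theorem sameActivity_stable_iff (s : Bool × Bool) :
    inst.SameActivity (stable s) 0 2 ↔ s = (true, false) := by
  have same_iff : ∀ s : Bool × Bool, (∃ b b' : Fin 4, some (assignment s 0) = some b ∧
      some (assignment s 2) = some b' ∧ inst.activity b = inst.activity b') ↔
      s = (true, false) := by decide
  exact same_iff s

theorem numSameActivity_stable (s : Bool × Bool) :
    inst.numSameActivity (stable s) = if s = (true, false) then 1 else 0 := by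
  classical
  rw [MSSPInstance.numSameActivity_of_siblings_eq_singleton rfl]
  simp only [sameActivity_stable_iff]

end SiblingExample

open SiblingExample

theorem mainTheorem12 :
    ∃ (A B Q : Type) (J : MSSPInstance A B Q),
      ¬ ∃ f : J.toSchoolInstance.StableMatching → ℝ,
        J.toSchoolInstance.MinCutRepresentable Set.univ (fun M => f M.1) ∧
        ∀ M M' : J.toSchoolInstance.StableMatching,
          f M < f M' ↔ J.numSameActivity M' < J.numSameActivity M := by
  refine ⟨Fin 4, Fin 4, Fin 3, inst, ?_⟩
  rintro ⟨f, hf, hlt⟩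
  have hsubmodular : f (stable (false, false)) + f (stable (true, true)) ≤
      f (stable (true, false)) + f (stable (false, true)) :=
    hf.add_le_add_of_diamond (K := ⟨_, trivial⟩) (M := ⟨_, trivial⟩) (N := ⟨_, trivial⟩)
      (L := ⟨_, trivial⟩) isElimination_stable_bot (stable_covBy_left false)
      (stable_covBy_right false) (stable_covBy_left true) (stable_injective.ne (by decide))
      (Subtype.ext ((rotationPair_left false).trans (rotationPair_left true).symm))
  have hleft : f (stable (true, false)) < f (stable (false, false)) := by
    simp [hlt, numSameActivity_stable]
  have hright : f (stable (false, true)) ≤ f (stable (true, true)) := by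
    simp [← not_lt, hlt, numSameActivity_stable]
  linarith
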